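/- **Corollary (length of return words).** Let $\lambda=(\lambda_1,\dots,\lambda_k)$ have strictly positive coordinates with $\sum_i\lambda_i=1$, let $\sigma$ be a permutation of $\{1,\dots,k\}$, put $X_i=[a_i,a_{i+1})$ with $a_i=\sum_{j<i}\lambda_j$, and let $T:[0,1)\to[0,1)$ be the interval exchange $T(x)=x+\sum_{m<\sigma^{-1}(i)}\lambda_{\sigma(m)}-\sum_{m<i}\lambda_m$ for $x\in X_i$. Assume that $T$ is regular: $T^n a_i=a_j$ with $i,j\in\{2,\dots,k\}$ and $n\in\mathbb Z$ implies $n=0$ and $i=j$. For $x\in[0,1)$ let $U(x)$ be the infinite word whose $n$-th letter ($n\ge 0$) is the index $i$ with $T^n x\in X_i$. Let $w$ be a factor of $U(x)$ and let $I_w$ be the set of the points $y$ such that $w$ is a prefix of $U(y)$. The induced intervals of $I_w$ are the maximal nonempty subintervals $J\subseteq I_w$ all of whose points have the same first return time $t>0$ to $I_w$ and for which each of $J,TJ,\dots,T^{t-1}J$ lies in a single $X_i$. There are exactly $k$ of them, $p_1,\dots,p_k$ from left to right. They cover $I_w$, and each $p_i$ contains its left endpoint $\ell_i$. For $y\in p_i$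 with first return time $t$, the prefix $r_i$ of length $t+|w|$ of $U(y)$ does not depend on $y$. The word $r_i$ is the $i$-th return word over $w$, read through the end of the second occurrence of $w$: the words $r_1,\dots,r_k$ are pairwise distinct, and they are exactly the words $vw$ where $v=U(x)_m\cdots U(x)_{n-1}$ for two consecutive positions $m<n$ of occurrences of $w$ in $U(x)$. For every $i$, $$|r_i|=|w|+k_i+k'_i,$$ where $k_i\ge 0$ is the least integer with $T^{-k_i}\ell_i\in I_w$ and $k'_i>0$ is the least integer with $T^{k'_i}\ell_i\in I_w$ (both exist). More generally, let $q\in[0,1)$ be any point whose backward orbit first meets $I_w$ in $\ell_i$, that is, $T^{-\kappa}q=\ell_i$ for the least $\kappa\ge 0$ with $T^{-\kappa}q\in I_w$. Then there is a least $\kappa'>0$ with $T^{\kappa'}q\in I_w$, and $|r_i|=|w|+\kappa+\kappa'$. -/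

import Mathlib

/-- Left end of the `i`-th block when blocks of lengths `μ 0, μ 1, …` are laid out
consecutively from `0`, that is `∑_{j < i} μ j`. -/
noncomputable def blockLeft {k : ℕ} (μ : Fin k → ℝ) (i : Fin k) : ℝ := ∑ j ∈ Finset.Iio i, μ j

theorem blockLeft_nonneg {k : ℕ} {μ : Fin k → ℝ} (hμ : ∀ i, 0 < μ i) (i : Fin k) :
    0 ≤ blockLeft μ i :=
  Finset.sum_nonneg fun j _ => (hμ j).le

theorem blockLeft_add {k : ℕ} (μ : Fin k → ℝ) (i : Fin k) :
    blockLeft μ i + μ i = ∑ j ∈ Finset.Iic i, μ j := by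
  have h : Finset.Iic i = insert i (Finset.Iio i) := by
    ext j
    simp [le_iff_eq_or_lt]
  rw [h, Finset.sum_insert (by simp), blockLeft, add_comm]

theorem blockLeft_add_le {k : ℕ} {μ : Fin k → ℝ} (hμ : ∀ i, 0 < μ i) (h1 : ∑ i, μ i = 1)
    (i : Fin k) : blockLeft μ i + μ i ≤ 1 := by
  rw [blockLeft_add, ← h1]
  exact Finset.sum_le_sum_of_subset_of_nonneg (Finset.subset_univ _) fun j _ _ => (hμ j).le

theorem blockLeft_add_le_of_lt {k : ℕ} {μ : Fin k → ℝ} (hμ : ∀ i, 0 < μ i) {i j : Fin k}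
    (hij : i < j) : blockLeft μ i + μ i ≤ blockLeft μ j := by
  rw [blockLeft_add]
  refine Finset.sum_le_sum_of_subset_of_nonneg ?_ fun j _ _ => (hμ j).le
  intro m hm
  simp only [Finset.mem_Iic, Finset.mem_Iio] at *
  exact lt_of_le_of_lt hm hij

theorem blockLeft_existsUnique {k : ℕ} {μ : Fin k → ℝ} (hμ : ∀ i, 0 < μ i) (h1 : ∑ i, μ i = 1)
    {x : ℝ} (hx : x ∈ Set.Ico (0 : ℝ) 1) :
    ∃! i, x ∈ Set.Ico (blockLeft μ i) (blockLeft μ i + μ i) := by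
  have hex : ∃ i, x < blockLeft μ i + μ i := by
    by_contra! hcon
    rcases k with _ | k
    · simp at h1
    · have h := hcon (Fin.last k)
      have h2 : Finset.Iic (Fin.last k) = Finset.univ := by
        ext j
        simp [Fin.le_last]
      rw [blockLeft_add, h2, h1] at h
      exact absurd hx.2 (not_lt.2 h)
  obtain ⟨i, hi, hmin⟩ := WellFounded.has_min (wellFounded_lt (α := Fin k))
    {i | x < blockLeft μ i + μ i} hex
  refine ⟨i, ⟨?_, hi⟩, ?_⟩
  · by_contra! hlt
    rcases Nat.eq_zero_or_pos i.val with h0 | hpos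
    · have : Finset.Iio i = ∅ := by
        ext j
        simp [Fin.lt_def, h0]
      rw [blockLeft, this, Finset.sum_empty] at hlt
      exact absurd hx.1 (not_le.2 hlt)
    · have hj : i.val - 1 < k := lt_of_le_of_lt (Nat.sub_le _ _) i.isLt
      refine hmin ⟨i.val - 1, hj⟩ ?_ (by rw [Fin.lt_def]; simp; omega)
      have hI : Finset.Iic (⟨i.val - 1, hj⟩ : Fin k) = Finset.Iio i := by
        ext j
        simp only [Finset.mem_Iic, Finset.mem_Iio, Fin.lt_def, Fin.le_def]
        omega
      change x < blockLeft μ _ + μ _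
      rw [blockLeft_add, hI]
      exact hlt
  · intro j hj
    rcases lt_trichotomy j i with h | h | h
    · exact absurd (blockLeft_add_le_of_lt hμ h) (by
        intro _
        exact hmin j hj.2 h)
    · exact h
    · exact absurd (blockLeft_add_le_of_lt hμ h) (not_le.2 (lt_of_le_of_lt hj.1 hi))

/-- The data `(σ, λ)` of an interval exchange of `k` intervals (letters are `0, …, k - 1`). -/
structure IntervalExchange (k : ℕ) where
  /-- The lengths of the intervals. -/
  len : Fin k → ℝ
  len_pos : ∀ i, 0 < len i
  sum_len : ∑ i, len i = 1
  /-- The permutation: the `m`-th interval from the left after the exchange is the image of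
  the interval with index `perm m`. -/
  perm : Equiv.Perm (Fin k)

namespace IntervalExchange

/-- The space `[0, 1)`. -/
abbrev Pt : Type := Set.Ico (0 : ℝ) 1

variable {k : ℕ} (E : IntervalExchange k)

/-- The lengths of the intervals in their order after the exchange. -/
def imageLen (m : Fin k) : ℝ := E.len (E.perm m)

theorem imageLen_pos (m : Fin k) : 0 < E.imageLen m := E.len_pos _

theorem sum_imageLen : ∑ m, E.imageLen m = 1 := by
  rw [← E.sum_len]
  exact Equiv.sum_comp E.perm E.len

/-- The interval `X_i = [∑_{j < i} λ_j, ∑_{j ≤ i} λ_j)`. -/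
def piece (i : Fin k) : Set Pt :=
  {x | (x : ℝ) ∈ Set.Ico (blockLeft E.len i) (blockLeft E.len i + E.len i)}

/-- The image of `X_{σ(m)}`: the `m`-th interval from the left after the exchange. -/
def imagePiece (m : Fin k) : Set Pt :=
  {x | (x : ℝ) ∈ Set.Ico (blockLeft E.imageLen m) (blockLeft E.imageLen m + E.imageLen m)}

theorem existsUnique_piece (x : Pt) : ∃! i, x ∈ E.piece i :=
  blockLeft_existsUnique E.len_pos E.sum_len x.2

theorem existsUnique_imagePiece (x : Pt) : ∃! m, x ∈ E.imagePiece m :=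
  blockLeft_existsUnique E.imageLen_pos E.sum_imageLen x.2

/-- The letter of a point: the index `i` with `x ∈ X_i`. -/
noncomputable def letter (x : Pt) : Fin k := (E.existsUnique_piece x).choose

theorem letter_mem (x : Pt) : x ∈ E.piece (E.letter x) := (E.existsUnique_piece x).choose_spec.1

theorem letter_eq {x : Pt} {i : Fin k} (h : x ∈ E.piece i) : E.letter x = i :=
  (E.existsUnique_piece x).unique (E.letter_mem x) h

/-- The index `m` of the interval after the exchange that contains the point. -/
noncomputable def imageLetter (x : Pt) : Fin k := (E.existsUnique_imagePiece x).choose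

theorem imageLetter_mem (x : Pt) : x ∈ E.imagePiece (E.imageLetter x) :=
  (E.existsUnique_imagePiece x).choose_spec.1

theorem imageLetter_eq {x : Pt} {m : Fin k} (h : x ∈ E.imagePiece m) : E.imageLetter x = m :=
  (E.existsUnique_imagePiece x).unique (E.imageLetter_mem x) h

/-- The translation `a_i = ∑_{m < σ⁻¹(i)} λ_{σ(m)} - ∑_{m < i} λ_m` applied to `X_i`. -/
noncomputable def shift (i : Fin k) : ℝ :=
  blockLeft E.imageLen (E.perm.symm i) - blockLeft E.len i

theorem fwd_mem (i : Fin k) {y : ℝ}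
    (h : y ∈ Set.Ico (blockLeft E.len i) (blockLeft E.len i + E.len i)) :
    y + E.shift i ∈ Set.Ico (blockLeft E.imageLen (E.perm.symm i))
      (blockLeft E.imageLen (E.perm.symm i) + E.imageLen (E.perm.symm i)) := by
  have h2 : E.imageLen (E.perm.symm i) = E.len i := by simp [imageLen]
  rw [h2, shift]
  constructor <;> linarith [h.1, h.2]

theorem bwd_mem (m : Fin k) {y : ℝ}
    (h : y ∈ Set.Ico (blockLeft E.imageLen m) (blockLeft E.imageLen m + E.imageLen m)) :
    y - E.shift (E.perm m) ∈ Set.Ico (blockLeft E.len (E.perm m))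
      (blockLeft E.len (E.perm m) + E.len (E.perm m)) := by
  have h2 : E.imageLen m = E.len (E.perm m) := rfl
  rw [h2] at h
  rw [shift, Equiv.symm_apply_apply]
  constructor <;> linarith [h.1, h.2]

theorem mem_unit_of_piece {i : Fin k} {y : ℝ}
    (h : y ∈ Set.Ico (blockLeft E.len i) (blockLeft E.len i + E.len i)) :
    y ∈ Set.Ico (0 : ℝ) 1 :=
  ⟨(blockLeft_nonneg E.len_pos i).trans h.1,
    h.2.trans_le (blockLeft_add_le E.len_pos E.sum_len i)⟩

theorem mem_unit_of_imagePiece {m : Fin k} {y : ℝ}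
    (h : y ∈ Set.Ico (blockLeft E.imageLen m) (blockLeft E.imageLen m + E.imageLen m)) :
    y ∈ Set.Ico (0 : ℝ) 1 :=
  ⟨(blockLeft_nonneg E.imageLen_pos m).trans h.1,
    h.2.trans_le (blockLeft_add_le E.imageLen_pos E.sum_imageLen m)⟩

/-- The interval exchange transformation `T x = x + a_i` for `x ∈ X_i`, as a bijection
of `[0, 1)`. -/
noncomputable def map : Equiv.Perm Pt where
  toFun x := ⟨x + E.shift (E.letter x), E.mem_unit_of_imagePiece (E.fwd_mem _ (E.letter_mem x))⟩
  invFun y := ⟨y - E.shift (E.perm (E.imageLetter y)),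
    E.mem_unit_of_piece (E.bwd_mem _ (E.imageLetter_mem y))⟩
  left_inv x := by
    apply Subtype.ext
    have h := E.imageLetter_eq (x := ⟨x + E.shift (E.letter x),
      E.mem_unit_of_imagePiece (E.fwd_mem _ (E.letter_mem x))⟩) (E.fwd_mem _ (E.letter_mem x))
    simp [h]
  right_inv y := by
    apply Subtype.ext
    have h := E.letter_eq (x := ⟨y - E.shift (E.perm (E.imageLetter y)),
      E.mem_unit_of_piece (E.bwd_mem _ (E.imageLetter_mem y))⟩)
      (E.bwd_mem _ (E.imageLetter_mem y))
    simp [h]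

/-- The left end of `X_i`, as a point of `[0, 1)`. -/
noncomputable def cut (i : Fin k) : Pt :=
  ⟨blockLeft E.len i, E.mem_unit_of_piece ⟨le_rfl, lt_add_of_pos_right _ (E.len_pos i)⟩⟩

/-- Regularity: `Tⁿ a_i = a_j`, with `a_i`, `a_j` left ends of intervals other than the
first one and `n ∈ ℤ`, only for `n = 0` and `i = j`. -/
def IsRegular : Prop :=
  ∀ i j : Fin k, i.val ≠ 0 → j.val ≠ 0 → ∀ n : ℤ,
    (E.map ^ n) (E.cut i) = E.cut j → n = 0 ∧ i = j

/-- The infinite word `U(x)`, the coding of the positive orbit of `x`. -/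
noncomputable def coding (x : Pt) (n : ℕ) : Fin k := E.letter ((E.map ^ n) x)

/-- The set `I_w` of the points whose coding starts with `w`:
`I_w = ⋂_{j < |w|} T^{-j} X_{w_j}`. -/
def cylinder (w : List (Fin k)) : Set Pt :=
  {y | ∀ j : Fin w.length, (E.map ^ (j : ℕ)) y ∈ E.piece (w.get j)}

/-- `t` is the least positive time at which the orbit of `y` is in `I`. -/
def IsReturnTime (I : Set Pt) (y : Pt) (t : ℕ) : Prop :=
  IsLeast {t : ℕ | 0 < t ∧ (E.map ^ t) y ∈ I} t

/-- `t` is the least time `t ≥ 0` at which the backward orbit of `y` is in `I`. -/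
def IsBackwardHittingTime (I : Set Pt) (y : Pt) (t : ℕ) : Prop :=
  IsLeast {t : ℕ | (E.map ^ (-(t : ℤ))) y ∈ I} t

/-- The intervals exchanged by the map induced by `T` on `I`: the maximal nonempty
subintervals `J` of `I` such that all points of `J` have the same first return time `t` to
`I`, and each of `J, T J, …, T^{t-1} J` lies in a single interval `X_i` (so that `T^t` acts
on `J` as a translation). -/
def IsInducedInterval (I J : Set Pt) : Prop :=
  Maximal (fun J : Set Pt => J.Nonempty ∧ J ⊆ I ∧ J.OrdConnected ∧
    ∃ t : ℕ, (∀ y ∈ J, E.IsReturnTime I y t) ∧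
      ∀ s < t, ∃ i : Fin k, ∀ y ∈ J, (E.map ^ s) y ∈ E.piece i) J

end IntervalExchange

/-- The word `u_n u_{n+1} ⋯ u_{n+m-1}`. -/
def wordSegment {A : Type*} (u : ℕ → A) (n m : ℕ) : List A := List.ofFn fun j : Fin m => u (n + j)

/-- The word `w` occurs in the infinite word `u` at position `n`. -/
def OccursAt {A : Type*} (u : ℕ → A) (w : List A) (n : ℕ) : Prop := wordSegment u n w.length = w

/-- `w` is a factor of the infinite word `u`. -/
def IsFactorOf {A : Type*} (w : List A) (u : ℕ → A) : Prop := ∃ n, OccursAt u w n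

/-- `v = u_m ⋯ u_{n-1}`, where `m < n` are consecutive positions of occurrences of `w` in
the infinite word `u`. -/
def IsReturnWord {A : Type*} (u : ℕ → A) (w v : List A) : Prop :=
  ∃ m n : ℕ, OccursAt u w m ∧ IsLeast {n : ℕ | m < n ∧ OccursAt u w n} n ∧
    v = wordSegment u m (n - m)

/-! An induced interval of `I_w` with return time `t` is a coding class: the set of points sharing
the same first `t + |w|` letters. Before time `t` the letters are constant by definition, and from
time `t` on they spell `w`. On such a class the powers of `T` up to `t + |w|` are translations, so
it is an interval with a least point, and the intervals are counted by these left endpoints.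

One endpoint is the minimum of `I_w`. Any other endpoint reaches a nonzero cut at some time in
`[|w|, t + |w|)`, and is the first point of `I_w` met from that cut at backward times `≥ |w|`.
Conversely each of the `k - 1` nonzero cuts yields such an endpoint; regularity makes different cuts
give different endpoints, none of them the minimum. This gives `k` intervals.

Return times, these pullbacks, and the occurrence of every return word in `U(x)` come from
recurrence: every forward and backward orbit visits every coding class infinitely often. For `k ≥ 2`
it follows from `IsRegular.eq_empty_or_univ`, applied to the complement of the set of right limit
points of an orbit. At an edge of an invariant set open to the right, one half-orbit avoids the
discontinuities and carries a left neighbourhood of fixed length along infinitely many distinct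
points, which pigeonhole forbids.

The length formulas split the return time of `ℓ i` at the point `q` of its orbit. -/

/-! ### Blocks, thresholds and pigeonhole -/

theorem block_eq_of_no_left {k : ℕ} {μ : Fin k → ℝ} (hμ : ∀ i, 0 < μ i) {u v : ℝ} {i j : Fin k}
    (hu : u ∈ Set.Ico (blockLeft μ i) (blockLeft μ i + μ i))
    (hv : v ∈ Set.Ico (blockLeft μ j) (blockLeft μ j + μ j)) (huv : u ≤ v)
    (h : ∀ m : Fin k, m.val ≠ 0 → ¬(u < blockLeft μ m ∧ blockLeft μ m ≤ v)) : i = j := by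
  rcases lt_trichotomy i j with hij | hij | hij
  · have h1 := blockLeft_add_le_of_lt hμ hij
    refine absurd ⟨hu.2.trans_le h1, hv.1⟩ (h j ?_)
    have := Fin.lt_def.1 hij
    omega
  · exact hij
  · have h1 := blockLeft_add_le_of_lt hμ hij
    linarith [hu.1, hv.2]

/-- A finite family of positive thresholds has a common positive lower bound. -/
theorem exists_pos_forall_of_finite {α : Type*} {D : Set α} (hD : D.Finite) {Q : α → ℝ → Prop}
    (hQ : ∀ d ∈ D, ∃ η > 0, Q d η) (hmono : ∀ d η η', η' ≤ η → Q d η → Q d η') :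
    ∃ η > 0, ∀ d ∈ D, Q d η := by
  induction D, hD using Set.Finite.induction_on with
  | empty => exact ⟨1, one_pos, by simp⟩
  | @insert a s _ _ ih =>
    obtain ⟨η, hη, h⟩ := ih fun d hd => hQ d (Set.mem_insert_of_mem _ hd)
    obtain ⟨η', hη', h'⟩ := hQ a (Set.mem_insert _ _)
    refine ⟨min η η', lt_min hη hη', fun d hd => ?_⟩
    rcases hd with rfl | hd
    · exact hmono _ _ _ (min_le_right _ _) h'
    · exact hmono _ _ _ (min_le_left _ _) (h d hd)

/-- Pigeonhole on cells of length `δ`. Only the indices are distinct; distinctness of the values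
comes from injectivity of the orbit where this is used. -/
theorem exists_ne_abs_sub_lt (f : ℕ → Set.Ico (0 : ℝ) 1) {δ : ℝ} (hδ : 0 < δ) :
    ∃ m n : ℕ, m < n ∧ |(f m : ℝ) - f n| < δ := by
  have hlt : ∀ n, ⌊(f n : ℝ) / δ⌋₊ < ⌊1 / δ⌋₊ + 1 := fun n =>
    Nat.lt_succ_of_le (Nat.floor_le_floor (by gcongr; exact (f n).2.2.le))
  obtain ⟨m, n, hmn, h⟩ := Finite.exists_ne_map_eq_of_infinite
    fun n => (⟨_, hlt n⟩ : Fin (⌊1 / δ⌋₊ + 1))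
  have key : |(f m : ℝ) - f n| < δ := by
    have h0 : ⌊(f m : ℝ) / δ⌋₊ = ⌊(f n : ℝ) / δ⌋₊ := by simpa using h
    have a1 := Nat.floor_le (div_nonneg (f m).2.1 hδ.le)
    have a2 := Nat.lt_floor_add_one ((f m : ℝ) / δ)
    have b1 := Nat.floor_le (div_nonneg (f n).2.1 hδ.le)
    have b2 := Nat.lt_floor_add_one ((f n : ℝ) / δ)
    rw [h0] at a1 a2
    have : |((f m : ℝ) - f n) / δ| < 1 := by
      rw [sub_div, abs_lt]
      constructor <;> linarith
    rwa [abs_div, abs_of_pos hδ, div_lt_one hδ] at this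
  rcases lt_or_gt_of_ne hmn with h1 | h1
  · exact ⟨m, n, h1, key⟩
  · exact ⟨n, m, h1, by rwa [abs_sub_comm]⟩

/-! ### Recurrence for piecewise translations -/

namespace IntervalExchange

/-- `S` acts as a translation on every interval `[u, v]` such that `(u, v]` avoids `D`. -/
def IsTranslationOff (S : Equiv.Perm Pt) (D : Set Pt) : Prop :=
  ∀ u v : Pt, u ≤ v → (∀ d ∈ D, ¬(u < d ∧ d ≤ v)) → (S v : ℝ) - S u = v - u

/-- Every point of `W` is the left end of an interval `[z, z + η)` contained in `W`. -/
def IsRightOpen (W : Set Pt) : Prop :=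
  ∀ z ∈ W, ∃ η > 0, ∀ z' : Pt, z ≤ z' → (z' : ℝ) < z + η → z' ∈ W

theorem IsTranslationOff.right_germ {S : Equiv.Perm Pt} {D : Set Pt} (hS : IsTranslationOff S D)
    (hD : D.Finite) (z : Pt) :
    ∃ η > 0, ∀ z' : Pt, z ≤ z' → (z' : ℝ) < z + η → (S z' : ℝ) - S z = z' - z := by
  obtain ⟨η, hη, h⟩ := exists_pos_forall_of_finite hD
    (Q := fun d η => z < d → (z : ℝ) + η ≤ d)
    (fun d _ => by
      by_cases hd : z < d
      · exact ⟨(d : ℝ) - z, sub_pos.2 hd, fun _ => by linarith⟩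
      · exact ⟨1, one_pos, fun h => absurd h hd⟩)
    (fun d η η' hle hQ hd => by linarith [hQ hd])
  refine ⟨η, hη, fun z' h1 h2 => hS z z' h1 fun d hd hdd => ?_⟩
  have h3 : (d : ℝ) ≤ z' := hdd.2
  linarith [h d hd hdd.1]

/-- The configuration "outside `W`, with a left neighbourhood of length `δ` inside `W`" is carried
by `S` along the whole orbit of `v`. Two distinct orbit points closer than `δ` then contradict each
other: the left one would be in `W`. -/
theorem IsTranslationOff.false_of_edge {S : Equiv.Perm Pt} {D : Set Pt}
    (hS : IsTranslationOff S D) (hD : D.Finite) {W : Set Pt} (hW : IsRightOpen W)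
    (hWS : ∀ z, S z ∈ W ↔ z ∈ W) {v : Pt} {ε : ℝ} (hε : 0 < ε) (hv : v ∉ W) (hεv : ε ≤ v)
    (hedge : ∀ z : Pt, (v : ℝ) - ε ≤ z → z < v → z ∈ W) (horb : ∀ n : ℕ, (S ^ n) v ∉ D)
    (hinj : ∀ m n : ℕ, (S ^ m) v = (S ^ n) v → m = n) : False := by
  obtain ⟨η, hη, h⟩ := exists_pos_forall_of_finite hD
    (Q := fun d η => d ∈ W → ∀ z' : Pt, d ≤ z' → (z' : ℝ) < d + η → z' ∈ W)
    (fun d _ => by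
      by_cases hd : d ∈ W
      · obtain ⟨η, hη, h⟩ := hW d hd
        exact ⟨η, hη, fun _ => h⟩
      · exact ⟨1, one_pos, fun h => absurd h hd⟩)
    (fun d η η' hle hQ hd z' h1 h2 => hQ hd z' h1 (by linarith))
  set δ := min ε η with hδ
  have hδ0 : 0 < δ := lt_min hε hη
  have hδε : δ ≤ ε := min_le_left _ _
  have hδη : δ ≤ η := min_le_right _ _
  have key : ∀ n : ℕ, (S ^ n) v ∉ W ∧ δ ≤ ((S ^ n) v : Pt) ∧
      ∀ z : Pt, (((S ^ n) v : Pt) : ℝ) - δ ≤ z → z < (S ^ n) v → z ∈ W := by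
    intro n
    induction n with
    | zero => exact ⟨hv, hδε.trans hεv, fun z h1 h2 => hedge z (by simp at h1; linarith) h2⟩
    | succ n ih =>
      have hb := horb n
      rw [pow_succ', Equiv.Perm.mul_apply]
      generalize (S ^ n) v = a at ih hb ⊢
      obtain ⟨i1, i2, i3⟩ := ih
      have htr : ∀ u : Pt, (a : ℝ) - δ ≤ u → u ≤ a → (S a : ℝ) - S u = a - u := by
        intro u hu1 hu2
        refine hS u a hu2 fun d hd hdd => ?_
        -- A point of `D` in `(u, a]` is not `a`, so it lies in `W`; as `δ ≤ η`, right-openness at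
        -- that point would put `a` in `W`.
        have hda : d < a := lt_of_le_of_ne hdd.2 fun h => hb (h ▸ hd)
        have h1 : (u : ℝ) < d := hdd.1
        exact i1 (h d hd (i3 d (by linarith) hda) a hdd.2 (by linarith))
      refine ⟨fun hc => i1 ((hWS a).1 hc), ?_, ?_⟩
      · have h1 := htr ⟨a - δ, by linarith, by linarith [a.2.2]⟩ le_rfl
          (Subtype.coe_le_coe.1 (by simp; linarith))
        have h2 := (S ⟨a - δ, by linarith, by linarith [a.2.2]⟩).2.1
        simp only at h1
        linarith
      · intro z hz1 hz2
        have hz3 : (z : ℝ) < S a := hz2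
        have h1 := htr ⟨a - (S a - z), by linarith, by linarith [a.2.2]⟩
          (by simp only; linarith) (Subtype.coe_le_coe.1 (by simp only; linarith))
        have h2 : S ⟨a - (S a - z), by linarith, by linarith [a.2.2]⟩ = z := by
          apply Subtype.ext
          simp only at h1
          linarith
        rw [← h2, hWS]
        exact i3 _ (by simp only; linarith) (Subtype.coe_lt_coe.1 (by simp only; linarith))
  obtain ⟨m, n, hmn, hlt⟩ := exists_ne_abs_sub_lt (fun n => (S ^ n) v) hδ0
  have hne : (S ^ m) v ≠ (S ^ n) v := fun h => hmn.ne (hinj m n h)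
  rw [abs_lt] at hlt
  rcases lt_or_gt_of_ne hne with h1 | h1
  · exact (key m).1 ((key n).2.2 _ (by linarith) h1)
  · exact (key n).1 ((key m).2.2 _ (by linarith) h1)

/-- The points whose right neighbourhoods are all visited infinitely often by `Sⁿ y`, `n ≥ 0`. -/
def rightLimitSet (S : Equiv.Perm Pt) (y : Pt) : Set Pt :=
  {z | ∀ η > 0, ∀ N : ℕ, ∃ n ≥ N, z ≤ (S ^ n) y ∧ (((S ^ n) y : Pt) : ℝ) < z + η}

theorem isRightOpen_compl_rightLimitSet (S : Equiv.Perm Pt) (y : Pt) :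
    IsRightOpen (rightLimitSet S y)ᶜ := by
  intro z hz
  simp only [rightLimitSet, Set.mem_compl_iff, Set.mem_ofPred_eq, not_forall, not_exists,
    not_and, not_lt] at hz ⊢
  obtain ⟨η, hη, N, h⟩ := hz
  refine ⟨η, hη, fun z' h1 h2 => ⟨z + η - z', by linarith, N, fun n hn h3 => ?_⟩⟩
  linarith [h n hn (h1.trans h3)]

theorem IsTranslationOff.map_mem_rightLimitSet {S : Equiv.Perm Pt} {D : Set Pt}
    (hS : IsTranslationOff S D) (hD : D.Finite) (y z : Pt) :
    S z ∈ rightLimitSet S y ↔ z ∈ rightLimitSet S y := by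
  obtain ⟨η₀, hη₀, h⟩ := hS.right_germ hD z
  constructor
  · intro hz η hη N
    have hz1 := z.2.2
    -- The bound `1 - z` keeps the point `z'` below `1`; asking for times `≥ N + 1` leaves room for
    -- a predecessor.
    obtain ⟨n, hn, h1, h2⟩ := hz (min (min η η₀) (1 - z))
      (lt_min (lt_min hη hη₀) (by linarith)) (N + 1)
    have h1' : (S z : ℝ) ≤ ((S ^ n) y : Pt) := h1
    have hle1 : min (min η η₀) (1 - (z : ℝ)) ≤ η := (min_le_left _ _).trans (min_le_left _ _)
    have hle2 : min (min η η₀) (1 - (z : ℝ)) ≤ η₀ := (min_le_left _ _).trans (min_le_right _ _)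
    have hle3 : min (min η η₀) (1 - (z : ℝ)) ≤ 1 - z := min_le_right _ _
    obtain ⟨n, rfl⟩ : ∃ n', n = n' + 1 := ⟨n - 1, by omega⟩
    let z' : Pt := ⟨z + ((((S ^ (n + 1)) y : Pt) : ℝ) - S z), by linarith [z.2.1], by linarith⟩
    have hz' : (z' : ℝ) = z + ((((S ^ (n + 1)) y : Pt) : ℝ) - S z) := rfl
    have h3 := h z' (Subtype.coe_le_coe.1 (by linarith)) (by linarith)
    have h4 : S z' = (S ^ (n + 1)) y := Subtype.ext (by linarith)
    rw [pow_succ', Equiv.Perm.mul_apply] at h4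
    have h5 := S.injective h4
    refine ⟨n, by omega, ?_, ?_⟩
    · rw [← h5]
      exact Subtype.coe_le_coe.1 (by linarith)
    · rw [← h5]
      linarith
  · intro hz η hη N
    obtain ⟨n, hn, h1, h2⟩ := hz (min η η₀) (lt_min hη hη₀) N
    have h3 := h _ h1 (by linarith [min_le_right η η₀])
    have h1' : (z : ℝ) ≤ ((S ^ n) y : Pt) := h1
    refine ⟨n + 1, by omega, ?_, ?_⟩ <;> rw [pow_succ', Equiv.Perm.mul_apply]
    · exact Subtype.coe_le_coe.1 (by linarith)
    · linarith [min_le_left η η₀]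

/-- Otherwise the orbit eventually stays `δ` away from the right side of every point of `D`. Two
late orbit points closer than `δ` then keep their difference forever, and the orbit contains an
unbounded arithmetic progression. -/
theorem IsTranslationOff.rightLimitSet_nonempty {S : Equiv.Perm Pt} {D : Set Pt}
    (hS : IsTranslationOff S D) (hD : D.Finite) {y : Pt}
    (hinj : ∀ m n : ℕ, (S ^ m) y = (S ^ n) y → m = n) : (rightLimitSet S y).Nonempty := by
  by_contra hemp
  rw [Set.not_nonempty_iff_eq_empty] at hemp
  have hall : ∀ d : Pt, ∃ η > (0 : ℝ), ∀ n : ℕ, 1 / η ≤ n → d ≤ (S ^ n) y →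
      (d : ℝ) + η ≤ ((S ^ n) y : Pt) := by
    intro d
    have hd : d ∉ rightLimitSet S y := by simp [hemp]
    simp only [rightLimitSet, Set.mem_ofPred_eq, not_forall, not_exists,
      not_and, not_lt] at hd
    obtain ⟨η, hη, N, h⟩ := hd
    -- One number records both the gap and the time from which it holds, since `1 / η ≤ n` now
    -- forces `N + 1 ≤ n`.
    refine ⟨min η (1 / (N + 1)), lt_min hη (by positivity), fun n hn h1 => ?_⟩
    have h2 : (N : ℝ) + 1 ≤ n := by
      refine le_trans ?_ hn
      rw [le_div_iff₀ (lt_min hη (by positivity))]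
      calc ((N : ℝ) + 1) * min η (1 / (N + 1)) ≤ (N + 1) * (1 / (N + 1)) := by
            gcongr
            exact min_le_right _ _
        _ = 1 := by field_simp
    have h3 : N ≤ n := by exact_mod_cast (by linarith : (N : ℝ) ≤ n)
    linarith [h n h3 h1, min_le_left η (1 / ((N : ℝ) + 1))]
  obtain ⟨δ, hδ, hδD⟩ := exists_pos_forall_of_finite (hD.insert (⟨0, by simp⟩ : Pt))
    (Q := fun d η => ∀ᶠ n : ℕ in Filter.atTop, d ≤ (S ^ n) y → (d : ℝ) + η ≤ ((S ^ n) y : Pt))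
    (fun d _ => by
      obtain ⟨η, hη, h⟩ := hall d
      refine ⟨η, hη, ?_⟩
      filter_upwards [Filter.eventually_ge_atTop ⌈1 / η⌉₊] with n hn
      exact h n ((Nat.le_ceil _).trans (by exact_mod_cast hn)))
    (fun d η η' hle hQ => hQ.mono fun n hn h => by linarith [hn h])
  obtain ⟨N, hN⟩ := Filter.eventually_atTop.1
    ((Filter.eventually_all_finite (hD.insert (⟨0, by simp⟩ : Pt))).2 hδD)
  have h0 : ∀ n ≥ N, δ ≤ ((S ^ n) y : Pt) := fun n hn => by
    have := hN n hn _ (Set.mem_insert _ _) (Subtype.coe_le_coe.1 ((S ^ n) y).2.1)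
    simpa using this
  have htr : ∀ n ≥ N, ∀ u : Pt, (((S ^ n) y : Pt) : ℝ) - δ < u → u ≤ (S ^ n) y →
      ((S ((S ^ n) y) : Pt) : ℝ) - S u = ((S ^ n) y : Pt) - u := by
    intro n hn u h1 h2
    refine hS u _ h2 fun d hd hdd => ?_
    have h3 := hN n hn d (Set.mem_insert_of_mem _ hd) hdd.2
    have h4 : (u : ℝ) < d := hdd.1
    linarith
  have hstep : ∀ (m n j : ℕ), N ≤ m → N ≤ n →
      |(((S ^ m) y : Pt) : ℝ) - ((S ^ n) y : Pt)| < δ →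
      (((S ^ (m + j)) y : Pt) : ℝ) - ((S ^ (n + j)) y : Pt) =
        ((S ^ m) y : Pt) - ((S ^ n) y : Pt) := by
    intro m n j hm hn hlt
    induction j with
    | zero => rfl
    | succ j ih =>
      rw [← ih] at hlt ⊢
      rw [abs_lt] at hlt
      rw [← add_assoc, ← add_assoc, pow_succ', Equiv.Perm.mul_apply, pow_succ',
        Equiv.Perm.mul_apply]
      rcases le_total ((S ^ (m + j)) y) ((S ^ (n + j)) y) with h | h
      · linarith [htr (n + j) (by omega) _ (by linarith) h]
      · linarith [htr (m + j) (by omega) _ (by linarith) h]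
  obtain ⟨m, n, hmn, hlt⟩ := exists_ne_abs_sub_lt (fun n => (S ^ (n + N)) y) hδ
  have hne : (S ^ (n + N)) y ≠ (S ^ (m + N)) y := fun h => by have := hinj _ _ h; omega
  set a : ℝ := (((S ^ (m + N)) y : Pt) : ℝ) with ha
  set d : ℝ := (((S ^ (n + N)) y : Pt) : ℝ) - a with hd
  have hd0 : d ≠ 0 := fun h => hne (Subtype.ext (by linarith))
  -- The two points are at times `n - m` apart, so the constant difference `d` is added at every
  -- further `n - m` steps.
  have hprog : ∀ i : ℕ, (((S ^ (m + N + i * (n - m))) y : Pt) : ℝ) = a + i * d := by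
    intro i
    induction i with
    | zero => simp [ha]
    | succ i ih =>
      have h1 := hstep (m + N) (n + N) (i * (n - m)) (by omega) (by omega) hlt
      have h2 : m + N + (i + 1) * (n - m) = n + N + i * (n - m) := by
        rw [add_mul]
        omega
      rw [h2, Nat.cast_succ]
      linarith
  obtain ⟨i, hi⟩ := exists_nat_gt (1 / |d|)
  rw [div_lt_iff₀ (abs_pos.2 hd0)] at hi
  have h1 := ((S ^ (m + N + i * (n - m))) y).2
  rw [hprog] at h1
  have h2 := ((S ^ (m + N)) y).2
  have h3 : |(i : ℝ) * d| < 1 := by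
    rw [abs_lt]
    constructor <;> linarith [h1.1, h1.2, h2.1, h2.2]
  rw [abs_mul, Nat.abs_cast] at h3
  linarith

end IntervalExchange

theorem perm_apply_inv_self {α : Type*} (f : Equiv.Perm α) (x : α) : f (f⁻¹ x) = x :=
  f.apply_symm_apply x

theorem perm_inv_apply_self {α : Type*} (f : Equiv.Perm α) (x : α) : f⁻¹ (f x) = x :=
  f.symm_apply_apply x

/-! ### Cuts and coding classes -/

namespace IntervalExchange

variable {k : ℕ} (E : IntervalExchange k)

theorem pos_card (E : IntervalExchange k) : 0 < k := by
  rcases Nat.eq_zero_or_pos k with rfl | h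
  · simpa using E.sum_len
  · exact h

theorem coe_map (x : Pt) : (E.map x : ℝ) = x + E.shift (E.letter x) := rfl

theorem letter_cut (i : Fin k) : E.letter (E.cut i) = i :=
  E.letter_eq ⟨le_rfl, lt_add_of_pos_right _ (E.len_pos i)⟩

theorem coe_cut (i : Fin k) : (E.cut i : ℝ) = blockLeft E.len i := rfl

theorem cut_le (y : Pt) : E.cut (E.letter y) ≤ y := (E.letter_mem y).1

theorem map_cut_perm (m : Fin k) :
    (E.map (E.cut (E.perm m)) : ℝ) = blockLeft E.imageLen m := by
  rw [coe_map, letter_cut, coe_cut, shift, Equiv.symm_apply_apply]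
  ring

theorem coe_cut_zero (i : Fin k) (hi : i.val = 0) : (E.cut i : ℝ) = 0 := by
  have : Finset.Iio i = ∅ := by
    ext j
    simp [Fin.lt_def, hi]
  rw [coe_cut, blockLeft, this, Finset.sum_empty]

/-- The left ends of the exchanged intervals other than the first one. -/
def cuts : Set Pt := {c | ∃ i : Fin k, i.val ≠ 0 ∧ c = E.cut i}

/-- The left ends of the intervals after the exchange other than the first one. -/
def imageCuts : Set Pt := {c | ∃ m : Fin k, m.val ≠ 0 ∧ c = E.map (E.cut (E.perm m))}

theorem finite_cuts : E.cuts.Finite :=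
  (Set.finite_range E.cut).subset (by rintro _ ⟨i, _, rfl⟩; exact ⟨i, rfl⟩)

theorem finite_imageCuts : E.imageCuts.Finite :=
  (Set.finite_range fun m => E.map (E.cut (E.perm m))).subset
    (by rintro _ ⟨i, _, rfl⟩; exact ⟨i, rfl⟩)

theorem isTranslationOff_map : IsTranslationOff E.map E.cuts := by
  intro u v huv h
  have h1 : E.letter u = E.letter v :=
    block_eq_of_no_left E.len_pos (E.letter_mem u) (E.letter_mem v) huv
      fun m hm hlt => h (E.cut m) ⟨m, hm, rfl⟩ hlt
  rw [coe_map, coe_map, h1]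
  ring

theorem coe_map_inv (y : Pt) :
    ((E.map⁻¹ y : Pt) : ℝ) = y - E.shift (E.perm (E.imageLetter y)) := rfl

theorem isTranslationOff_map_inv : IsTranslationOff E.map⁻¹ E.imageCuts := by
  intro u v huv h
  have h1 : E.imageLetter u = E.imageLetter v := by
    refine block_eq_of_no_left E.imageLen_pos (E.imageLetter_mem u) (E.imageLetter_mem v) huv
      fun m hm hlt => h (E.map (E.cut (E.perm m))) ⟨m, hm, rfl⟩ ?_
    rw [← Subtype.coe_lt_coe, ← Subtype.coe_le_coe, map_cut_perm]
    exact hlt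
  rw [coe_map_inv, coe_map_inv, h1]
  ring

/-- The points whose codings agree with that of `y` in the first `n` letters. -/
def codingClass (n : ℕ) (y : Pt) : Set Pt := {z | ∀ j < n, E.coding z j = E.coding y j}

theorem self_mem_codingClass (n : ℕ) (y : Pt) : y ∈ E.codingClass n y := fun _ _ => rfl

variable {E}

theorem codingClass_eq {n : ℕ} {y z : Pt} (h : z ∈ E.codingClass n y) :
    E.codingClass n z = E.codingClass n y := by
  ext u
  exact ⟨fun hu j hj => (hu j hj).trans (h j hj), fun hu j hj => (hu j hj).trans (h j hj).symm⟩

theorem codingClass_anti {m n : ℕ} (hmn : m ≤ n) (y : Pt) :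
    E.codingClass n y ⊆ E.codingClass m y := fun _ hz j hj => hz j (hj.trans_le hmn)

theorem map_pow_sub_of_mem_codingClass {n : ℕ} {y z : Pt} (h : z ∈ E.codingClass n y) :
    (((E.map ^ n) z : Pt) : ℝ) - ((E.map ^ n) y : Pt) = z - y := by
  induction n with
  | zero => rfl
  | succ n ih =>
    have h1 := ih (codingClass_anti n.le_succ y h)
    have h2 : E.letter ((E.map ^ n) z) = E.letter ((E.map ^ n) y) := h n n.lt_succ_self
    rw [pow_succ', Equiv.Perm.mul_apply, Equiv.Perm.mul_apply, coe_map, coe_map, h2]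
    linarith

theorem letter_eq_of_le_of_le {u v z : Pt} (huv : u ≤ v) (hvz : v ≤ z)
    (h : E.letter u = E.letter z) : E.letter v = E.letter z := by
  refine E.letter_eq ⟨?_, lt_of_le_of_lt hvz (E.letter_mem z).2⟩
  rw [← h]
  exact (E.letter_mem u).1.trans huv

theorem mem_codingClass_of_le_of_le {n : ℕ} {y u v z : Pt} (hu : u ∈ E.codingClass n y)
    (hz : z ∈ E.codingClass n y) (huv : u ≤ v) (hvz : v ≤ z) : v ∈ E.codingClass n y := by
  induction n with
  | zero => exact fun j hj => absurd hj (Nat.not_lt_zero j)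
  | succ n ih =>
    have hu' := codingClass_anti n.le_succ y hu
    have hz' := codingClass_anti n.le_succ y hz
    have hv := ih hu' hz'
    have h1 := map_pow_sub_of_mem_codingClass hu'
    have h2 := map_pow_sub_of_mem_codingClass hz'
    have h3 := map_pow_sub_of_mem_codingClass hv
    have huv' : (u : ℝ) ≤ v := huv
    have hvz' : (v : ℝ) ≤ z := hvz
    intro j hj
    rcases Nat.lt_succ_iff_lt_or_eq.1 hj with hj | rfl
    · exact hv j hj
    · rw [← hz j hj]
      exact letter_eq_of_le_of_le (u := (E.map ^ j) u) (Subtype.coe_le_coe.1 (by linarith))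
        (Subtype.coe_le_coe.1 (by linarith)) ((hu j hj).trans (hz j hj).symm)

theorem ordConnected_codingClass (n : ℕ) (y : Pt) : (E.codingClass n y).OrdConnected :=
  ⟨fun _ hu _ hz _ hv => mem_codingClass_of_le_of_le hu hz hv.1 hv.2⟩

theorem exists_Ico_subset_codingClass (n : ℕ) (y : Pt) :
    ∃ η > 0, ∀ z : Pt, y ≤ z → (z : ℝ) < y + η → z ∈ E.codingClass n y := by
  induction n with
  | zero => exact ⟨1, one_pos, fun z _ _ j hj => absurd hj (Nat.not_lt_zero j)⟩
  | succ n ih =>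
    obtain ⟨η, hη, h⟩ := ih
    set a := (E.map ^ n) y with ha
    have hm := E.letter_mem a
    refine ⟨min η (blockLeft E.len (E.letter a) + E.len (E.letter a) - a),
      lt_min hη (sub_pos.2 hm.2), fun z h1 h2 => ?_⟩
    have h3 := h z h1 (h2.trans_le (by gcongr; exact min_le_left _ _))
    have h4 := map_pow_sub_of_mem_codingClass h3
    have h5 := min_le_right η (blockLeft E.len (E.letter a) + E.len (E.letter a) - a)
    have h1' : (y : ℝ) ≤ z := h1
    have h6 := hm.1
    intro j hj
    rcases Nat.lt_succ_iff_lt_or_eq.1 hj with hj | rfl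
    · exact h3 j hj
    · refine E.letter_eq ⟨?_, ?_⟩
      · change blockLeft E.len (E.letter a) ≤ _
        linarith
      · change _ < blockLeft E.len (E.letter a) + E.len (E.letter a)
        linarith

/-- A coding class has a least element, which is `0` or is mapped to a nonzero cut. -/
theorem exists_isLeast_codingClass (n : ℕ) (y : Pt) :
    ∃ ℓ, IsLeast (E.codingClass n y) ℓ ∧
      ((ℓ : ℝ) = 0 ∨ ∃ j < n, ∃ i : Fin k, i.val ≠ 0 ∧ (E.map ^ j) ℓ = E.cut i) := by
  induction n with
  | zero =>
    exact ⟨⟨0, by simp⟩, ⟨fun j hj => absurd hj (Nat.not_lt_zero j), fun z _ => z.2.1⟩, Or.inl rfl⟩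
  | succ n ih =>
    obtain ⟨ℓ, hℓ, h⟩ := ih
    have hly : ℓ ≤ y := hℓ.2 (E.self_mem_codingClass n y)
    have hly' : (ℓ : ℝ) ≤ y := hly
    have htr := map_pow_sub_of_mem_codingClass hℓ.1
    set a := (E.map ^ n) y with ha
    rcases le_or_gt (E.cut (E.letter a)) ((E.map ^ n) ℓ) with hle | hlt
    · refine ⟨ℓ, ⟨?_, fun z hz => hℓ.2 (codingClass_anti n.le_succ y hz)⟩, ?_⟩
      · intro j hj
        rcases Nat.lt_succ_iff_lt_or_eq.1 hj with hj | rfl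
        · exact hℓ.1 j hj
        · have := letter_eq_of_le_of_le hle (Subtype.coe_le_coe.1 (by linarith))
            (E.letter_cut (E.letter a))
          exact this
      · rcases h with h | ⟨j, hj, h⟩
        · exact Or.inl h
        · exact Or.inr ⟨j, hj.trans n.lt_succ_self, h⟩
    -- The new letter trims the class on the left: its least point becomes the point `z` sent by
    -- `T^n` exactly to the cut.
    · have hlt' : (((E.map ^ n) ℓ : Pt) : ℝ) < E.cut (E.letter a) := hlt
      have hca : (E.cut (E.letter a) : ℝ) ≤ a := E.cut_le a
      let z : Pt := ⟨ℓ + (E.cut (E.letter a) - ((E.map ^ n) ℓ : Pt)), by linarith [ℓ.2.1],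
        by linarith [y.2.2]⟩
      have hz : (z : ℝ) = ℓ + (E.cut (E.letter a) - ((E.map ^ n) ℓ : Pt)) := rfl
      have hzc : z ∈ E.codingClass n y := mem_codingClass_of_le_of_le hℓ.1
        (E.self_mem_codingClass n y) (Subtype.coe_le_coe.1 (by linarith))
        (Subtype.coe_le_coe.1 (by linarith))
      have hzt := map_pow_sub_of_mem_codingClass hzc
      have hzn : (E.map ^ n) z = E.cut (E.letter a) := Subtype.ext (by linarith)
      refine ⟨z, ⟨?_, fun u hu => ?_⟩, Or.inr ⟨n, n.lt_succ_self, E.letter a, fun h0 => ?_, hzn⟩⟩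
      · intro j hj
        rcases Nat.lt_succ_iff_lt_or_eq.1 hj with hj | rfl
        · exact hzc j hj
        · change E.letter ((E.map ^ j) z) = _
          rw [hzn, letter_cut]
          rfl
      · have hut := map_pow_sub_of_mem_codingClass (codingClass_anti n.le_succ y hu)
        have hul : E.letter ((E.map ^ n) u) = E.letter a := hu n n.lt_succ_self
        have huc : (E.cut (E.letter ((E.map ^ n) u)) : ℝ) ≤ ((E.map ^ n) u : Pt) := E.cut_le _
        rw [hul] at huc
        exact Subtype.coe_le_coe.1 (by linarith)
      · rw [E.coe_cut_zero _ h0] at hlt'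
        exact absurd hlt' (not_lt.2 ((E.map ^ n) ℓ).2.1)

/-! ### Aperiodicity and minimality -/

/-- If the first interval stayed first, the second image interval would begin at the second cut, so
`T` would send a nonzero cut to a nonzero cut. This lets the point `0` be treated as the image of a
nonzero cut. -/
theorem exists_map_cut_eq_zero (hE : E.IsRegular) (hk : 2 ≤ k) :
    ∃ i : Fin k, i.val ≠ 0 ∧ (E.map (E.cut i) : ℝ) = 0 := by
  let i0 : Fin k := ⟨0, by omega⟩
  let i1 : Fin k := ⟨1, by omega⟩
  have h0 : (E.map (E.cut (E.perm i0)) : ℝ) = 0 := by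
    have : Finset.Iio i0 = ∅ := by
      ext j
      simp [Fin.lt_def, i0]
    rw [map_cut_perm, blockLeft, this, Finset.sum_empty]
  refine ⟨E.perm i0, fun hp => ?_, h0⟩
  have hp0 : E.perm i0 = i0 := Fin.ext hp
  have hI : Finset.Iio i1 = {i0} := by
    ext j
    simp only [Finset.mem_Iio, Finset.mem_singleton, Fin.lt_def, Fin.ext_iff, i0, i1]
    omega
  have h1 : E.map (E.cut (E.perm i1)) = E.cut i1 := by
    apply Subtype.ext
    rw [map_cut_perm, coe_cut, blockLeft, blockLeft, hI, Finset.sum_singleton,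
      Finset.sum_singleton, imageLen, hp0]
  have hne : (E.perm i1).val ≠ 0 := by
    intro h
    have h2 : E.perm i1 = E.perm i0 := by
      rw [hp0]
      exact Fin.ext h
    have := congrArg Fin.val (E.perm.injective h2)
    simp [i0, i1] at this
  have := (hE (E.perm i1) i1 hne one_ne_zero 1 (by simpa using h1)).1
  exact one_ne_zero this

theorem IsRegular.eq_zero_of_map_pow_eq (hE : E.IsRegular) {i j : Fin k} (hi : i.val ≠ 0)
    (hj : j.val ≠ 0) {n : ℕ} (h : (E.map ^ n) (E.cut i) = E.cut j) : n = 0 := by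
  have := (hE i j hi hj n (by rwa [zpow_natCast])).1
  exact_mod_cast this

theorem IsRegular.map_pow_zero_ne_cut (hE : E.IsRegular) (hk : 2 ≤ k) {z : Pt} (hz : (z : ℝ) = 0)
    (n : ℕ) {j : Fin k} (hj : j.val ≠ 0) : (E.map ^ n) z ≠ E.cut j := by
  obtain ⟨i, hi, h⟩ := exists_map_cut_eq_zero hE hk
  intro hc
  have : E.map (E.cut i) = z := Subtype.ext (h.trans hz.symm)
  rw [← this, ← Equiv.Perm.mul_apply, ← pow_succ] at hc
  exact absurd (hE.eq_zero_of_map_pow_eq hi hj hc) (Nat.succ_ne_zero n)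

/-- A periodic point makes `T^n` the identity on its coding class, hence periodic at the least
point; that point is `0` or reaches a nonzero cut, and either way a nonzero cut is periodic. -/
theorem IsRegular.map_pow_ne (hE : E.IsRegular) (hk : 2 ≤ k) {n : ℕ} (hn : n ≠ 0) (y : Pt) :
    (E.map ^ n) y ≠ y := by
  intro hy
  obtain ⟨ℓ, hℓ, h⟩ := exists_isLeast_codingClass (E := E) n y
  have htr := map_pow_sub_of_mem_codingClass hℓ.1
  rw [hy] at htr
  have hper : (E.map ^ n) ℓ = ℓ := Subtype.ext (by linarith)
  rcases h with h | ⟨j, -, i, hi, h⟩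
  · obtain ⟨i, hi, hi0⟩ := exists_map_cut_eq_zero hE hk
    have h1 : E.map (E.cut i) = ℓ := Subtype.ext (hi0.trans h.symm)
    rw [← h1, ← Equiv.Perm.mul_apply, ← pow_succ, pow_succ', Equiv.Perm.mul_apply] at hper
    exact hn (hE.eq_zero_of_map_pow_eq hi hi (E.map.injective hper))
  · refine hn (hE.eq_zero_of_map_pow_eq hi hi ?_)
    rw [← h, ← Equiv.Perm.mul_apply, (Commute.pow_pow_self E.map n j).eq, Equiv.Perm.mul_apply,
      hper]

theorem IsRegular.map_pow_injective (hE : E.IsRegular) (hk : 2 ≤ k) (y : Pt) (m n : ℕ)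
    (h : (E.map ^ m) y = (E.map ^ n) y) : m = n := by
  wlog hmn : m ≤ n generalizing m n
  · exact (this n m h.symm (by omega)).symm
  obtain ⟨d, rfl⟩ := Nat.exists_eq_add_of_le hmn
  rw [pow_add, Equiv.Perm.mul_apply] at h
  by_contra hne
  exact hE.map_pow_ne hk (n := d) (by omega) y ((E.map ^ m).injective h).symm

theorem IsRegular.map_inv_pow_injective (hE : E.IsRegular) (hk : 2 ≤ k) (y : Pt) (m n : ℕ)
    (h : (E.map⁻¹ ^ m) y = (E.map⁻¹ ^ n) y) : m = n := by
  have h1 := congrArg (E.map ^ (m + n)) h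
  rw [← Equiv.Perm.mul_apply, ← Equiv.Perm.mul_apply, inv_pow, inv_pow, pow_add,
    mul_inv_cancel_right, (Commute.pow_pow_self E.map m n).eq, mul_inv_cancel_right] at h1
  exact (hE.map_pow_injective hk y n m h1).symm

theorem mem_iff_map_inv_mem {W : Set Pt} (hW : ∀ z, E.map z ∈ W ↔ z ∈ W) (z : Pt) :
    E.map⁻¹ z ∈ W ↔ z ∈ W := by
  rw [← hW, perm_apply_inv_self]

/-- Hitting a cut forward and an image cut backward would connect two cuts in at least one step. If
the starting cut is `0`, the connection is excluded by `map_pow_zero_ne_cut`. -/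
theorem IsRegular.orbit_avoids (hE : E.IsRegular) (hk : 2 ≤ k) (v : Pt) :
    (∀ n : ℕ, (E.map ^ n) v ∉ E.cuts) ∨ ∀ n : ℕ, (E.map⁻¹ ^ n) v ∉ E.imageCuts := by
  by_contra! hcon
  obtain ⟨⟨n, i, hi, h1⟩, m, j, -, h2⟩ := hcon
  have h3 : v = (E.map ^ (m + 1)) (E.cut (E.perm j)) := by
    rw [pow_succ, Equiv.Perm.mul_apply, ← h2, inv_pow, perm_apply_inv_self]
  rw [h3, ← Equiv.Perm.mul_apply, ← pow_add] at h1
  by_cases hj : (E.perm j).val = 0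
  · exact hE.map_pow_zero_ne_cut hk (E.coe_cut_zero _ hj) _ hi h1
  · have := hE.eq_zero_of_map_pow_eq hj hi h1
    omega

/-- The infimum of the points outside `W` to the right of `y` is an edge, to which `false_of_edge`
applies for `T` or for its inverse. -/
theorem IsRegular.false_of_mem_of_lt (hE : E.IsRegular) (hk : 2 ≤ k) {W : Set Pt}
    (hWo : IsRightOpen W) (hW : ∀ z, E.map z ∈ W ↔ z ∈ W) {y z : Pt} (hy : y ∈ W) (hz : z ∉ W)
    (hyz : y < z) : False := by
  let s : Set ℝ := {t | ∃ u : Pt, (u : ℝ) = t ∧ y ≤ u ∧ u ∉ W}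
  have hzs : (z : ℝ) ∈ s := ⟨z, rfl, hyz.le, hz⟩
  have hbdd : BddBelow s := ⟨y, by rintro _ ⟨u, rfl, hu, -⟩; exact hu⟩
  have hyv : (y : ℝ) ≤ sInf s := le_csInf ⟨_, hzs⟩ (by rintro _ ⟨u, rfl, hu, -⟩; exact hu)
  have hvz : sInf s ≤ z := csInf_le hbdd hzs
  obtain ⟨v, hv⟩ : ∃ v : Pt, (v : ℝ) = sInf s :=
    ⟨⟨sInf s, y.2.1.trans hyv, hvz.trans_lt z.2.2⟩, rfl⟩
  have hvW : v ∉ W := by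
    intro hvW
    obtain ⟨η, hη, h⟩ := hWo v hvW
    obtain ⟨_, ⟨u, rfl, hu, huW⟩, hlt⟩ := exists_lt_of_csInf_lt ⟨_, hzs⟩
      (lt_add_of_pos_right (sInf s) hη)
    exact huW (h u (Subtype.coe_le_coe.1 (hv ▸ csInf_le hbdd ⟨u, rfl, hu, huW⟩)) (hv ▸ hlt))
  have hyv' : y < v := lt_of_le_of_ne (Subtype.coe_le_coe.1 (hv ▸ hyv)) fun h => hvW (h ▸ hy)
  have hyv'' : (y : ℝ) < v := hyv'
  have hedge : ∀ u : Pt, (v : ℝ) - (v - y) ≤ u → u < v → u ∈ W := by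
    intro u hu1 hu2
    by_contra huW
    have h1 : (v : ℝ) ≤ u := hv ▸ csInf_le hbdd
      ⟨u, rfl, Subtype.coe_le_coe.1 (by linarith), huW⟩
    exact absurd hu2 (not_lt.2 h1)
  have hpos : (v : ℝ) - y ≤ v := by linarith [y.2.1]
  rcases hE.orbit_avoids hk v with h | h
  · exact E.isTranslationOff_map.false_of_edge E.finite_cuts hWo hW (sub_pos.2 hyv'') hvW hpos
      hedge h (hE.map_pow_injective hk v)
  · exact E.isTranslationOff_map_inv.false_of_edge E.finite_imageCuts hWo
      (mem_iff_map_inv_mem hW) (sub_pos.2 hyv'') hvW hpos hedge h (hE.map_inv_pow_injective hk v)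

/-- An invariant set that is open to the right is trivial. -/
theorem IsRegular.eq_empty_or_univ (hE : E.IsRegular) (hk : 2 ≤ k) {W : Set Pt}
    (hWo : IsRightOpen W) (hW : ∀ z, E.map z ∈ W ↔ z ∈ W) : W = ∅ ∨ W = Set.univ := by
  by_contra! hcon
  obtain ⟨⟨y, hy⟩, hne⟩ := hcon
  obtain ⟨z, hz⟩ := (Set.ne_univ_iff_exists_notMem W).1 hne
  have hlt : ∀ y ∈ W, ∀ z ∉ W, z < y := by
    intro y hy z hz
    by_contra! hle
    exact hE.false_of_mem_of_lt hk hWo hW hy hz (lt_of_le_of_ne hle fun h => hz (h ▸ hy))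
  -- The complement is now an initial segment. If it is open to the right, the same argument applies
  -- to it; if not, it has a greatest point `u`.
  by_cases hV : IsRightOpen Wᶜ
  · exact hE.false_of_mem_of_lt hk hV (fun z => not_congr (hW z)) hz (by simpa using hy)
      (hlt y hy z hz)
  rw [IsRightOpen] at hV
  push Not at hV
  obtain ⟨u, hu, h⟩ := hV
  simp only [Set.mem_compl_iff, not_not] at hu h
  have hmax : ∀ z ∉ W, z ≤ u := by
    intro z hz
    by_contra! huz
    have huz' : (u : ℝ) < z := huz
    obtain ⟨z', -, h2, h3⟩ := h (z - u) (sub_pos.2 huz')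
    exact absurd (hlt z' h3 z hz) (not_lt.2 (Subtype.coe_le_coe.1 (by linarith)))
  have hpre : E.map⁻¹ u ∉ W := fun hc => hu ((mem_iff_map_inv_mem hW u).1 hc)
  set t := E.map⁻¹ u with ht
  have hTt : E.map t = u := perm_apply_inv_self _ _
  -- Points slightly to the right of `t < u` remain in the complement but are mapped beyond `u`; and
  -- `t = u` would be a fixed point.
  rcases (hmax t hpre).lt_or_eq with htu | htu
  · obtain ⟨η, hη, hg⟩ := E.isTranslationOff_map.right_germ E.finite_cuts t
    have htu' : (t : ℝ) < u := htu
    obtain ⟨b, hb1, hb2⟩ := exists_between (lt_min (lt_add_of_pos_right (t : ℝ) hη) htu')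
    let z' : Pt := ⟨b, t.2.1.trans hb1.le, (hb2.trans_le (min_le_right _ _)).trans u.2.2⟩
    have hz' : (z' : ℝ) = b := rfl
    have h1 := hg z' (Subtype.coe_le_coe.1 hb1.le) (hb2.trans_le (min_le_left _ _))
    have h2 : z' ∉ W := fun hc => absurd (hlt z' hc u hu)
      (not_lt.2 (Subtype.coe_le_coe.1 (hb2.le.trans (min_le_right _ _))))
    have h3 : (E.map z' : ℝ) ≤ u := hmax _ fun hc => h2 ((hW z').1 hc)
    rw [hTt] at h1
    linarith
  · rw [htu] at hTt
    exact hE.map_pow_ne hk one_ne_zero u (by simpa using hTt)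

/-- With one letter `T` is the identity and orbits are not dense, but recurrence to coding classes
still holds trivially. -/
theorem codingClass_eq_univ_of_card_lt_two (hk : ¬2 ≤ k) (n : ℕ) (y : Pt) :
    E.codingClass n y = Set.univ := by
  refine Set.eq_univ_of_forall fun z j _ => Fin.ext ?_
  have := (E.coding z j).isLt
  have := (E.coding y j).isLt
  omega

theorem exists_ge_mem_of_rightLimitSet_eq_univ {S : Equiv.Perm Pt} {y : Pt}
    (h : rightLimitSet S y = Set.univ) (n : ℕ) (z : Pt) (N : ℕ) :
    ∃ m ≥ N, (S ^ m) y ∈ E.codingClass n z := by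
  obtain ⟨η, hη, hz⟩ := exists_Ico_subset_codingClass (E := E) n z
  obtain ⟨m, hm, h1, h2⟩ := (h ▸ Set.mem_univ z : z ∈ rightLimitSet S y) η hη N
  exact ⟨m, hm, hz _ h1 h2⟩

theorem IsRegular.exists_ge_map_pow_mem (hE : E.IsRegular) (y : Pt) (n : ℕ) (z : Pt) (N : ℕ) :
    ∃ m ≥ N, (E.map ^ m) y ∈ E.codingClass n z := by
  by_cases hk : 2 ≤ k
  · refine exists_ge_mem_of_rightLimitSet_eq_univ ?_ n z N
    rcases hE.eq_empty_or_univ hk (isRightOpen_compl_rightLimitSet E.map y) fun z => not_congr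
      (E.isTranslationOff_map.map_mem_rightLimitSet E.finite_cuts y z) with h | h
    · exact Set.compl_empty_iff.1 h
    · exact absurd (Set.compl_univ_iff.1 h)
        (E.isTranslationOff_map.rightLimitSet_nonempty E.finite_cuts
          (hE.map_pow_injective hk y)).ne_empty
  · exact ⟨N, le_rfl, by rw [codingClass_eq_univ_of_card_lt_two hk]; trivial⟩

theorem IsRegular.exists_ge_map_inv_pow_mem (hE : E.IsRegular) (y : Pt) (n : ℕ) (z : Pt)
    (N : ℕ) : ∃ m ≥ N, (E.map⁻¹ ^ m) y ∈ E.codingClass n z := by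
  by_cases hk : 2 ≤ k
  · have hinv := E.isTranslationOff_map_inv.map_mem_rightLimitSet E.finite_imageCuts y
    refine exists_ge_mem_of_rightLimitSet_eq_univ ?_ n z N
    rcases hE.eq_empty_or_univ hk (isRightOpen_compl_rightLimitSet E.map⁻¹ y) fun z => not_congr
      (by rw [← hinv, perm_inv_apply_self]) with h | h
    · exact Set.compl_empty_iff.1 h
    · exact absurd (Set.compl_univ_iff.1 h)
        (E.isTranslationOff_map_inv.rightLimitSet_nonempty E.finite_imageCuts
          (hE.map_inv_pow_injective hk y)).ne_empty
  · exact ⟨N, le_rfl, by rw [codingClass_eq_univ_of_card_lt_two hk]; trivial⟩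

end IntervalExchange

/-! ### Words, occurrences and cylinders -/

theorem wordSegment_eq_iff {A : Type*} {u u' : ℕ → A} {n n' m : ℕ} :
    wordSegment u n m = wordSegment u' n' m ↔ ∀ j < m, u (n + j) = u' (n' + j) := by
  rw [wordSegment, wordSegment, List.ofFn_inj, funext_iff]
  exact ⟨fun h j hj => h ⟨j, hj⟩, fun h j => h j j.2⟩

theorem length_wordSegment {A : Type*} (u : ℕ → A) (n m : ℕ) :
    (wordSegment u n m).length = m := List.length_ofFn

theorem wordSegment_append {A : Type*} (u : ℕ → A) (n m m' : ℕ) :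
    wordSegment u n m ++ wordSegment u (n + m) m' = wordSegment u n (m + m') := by
  rw [wordSegment, wordSegment, wordSegment, List.ofFn_add]
  simp [add_assoc]

namespace IntervalExchange

variable {k : ℕ} {E : IntervalExchange k} {w : List (Fin k)}

theorem mem_piece_iff {y : Pt} {i : Fin k} : y ∈ E.piece i ↔ E.letter y = i :=
  ⟨E.letter_eq, fun h => h ▸ E.letter_mem y⟩

theorem coding_map_pow (y : Pt) (n j : ℕ) : E.coding ((E.map ^ n) y) j = E.coding y (n + j) := by
  rw [coding, coding, ← Equiv.Perm.mul_apply, ← pow_add, add_comm]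

theorem mem_cylinder_iff {y : Pt} :
    y ∈ E.cylinder w ↔ ∀ j : Fin w.length, E.coding y j = w.get j :=
  forall_congr' fun _ => mem_piece_iff

theorem cylinder_eq_codingClass {y : Pt} (hy : y ∈ E.cylinder w) :
    E.cylinder w = E.codingClass w.length y := by
  rw [mem_cylinder_iff] at hy
  ext z
  rw [mem_cylinder_iff]
  exact ⟨fun h j hj => (h ⟨j, hj⟩).trans (hy ⟨j, hj⟩).symm, fun h j => (h j j.2).trans (hy j)⟩

theorem occursAt_coding_iff {x : Pt} {n : ℕ} :
    OccursAt (E.coding x) w n ↔ (E.map ^ n) x ∈ E.cylinder w := by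
  have hw : w = List.ofFn w.get := (List.ofFn_get w).symm
  rw [mem_cylinder_iff, OccursAt, wordSegment]
  conv_lhs => rhs; rw [hw]
  rw [List.ofFn_inj, funext_iff]
  simp_rw [coding_map_pow]

theorem map_pow_mem_cylinder_iff {n s : ℕ} (hs : s + w.length ≤ n) {y z : Pt}
    (h : z ∈ E.codingClass n y) :
    (E.map ^ s) z ∈ E.cylinder w ↔ (E.map ^ s) y ∈ E.cylinder w := by
  simp_rw [mem_cylinder_iff, coding_map_pow]
  exact forall_congr' fun j => by rw [h (s + j) (by have := j.2; omega)]

/-! ### Return times and induced intervals -/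

theorem IsReturnTime.of_mem_codingClass {y z : Pt} {t : ℕ}
    (ht : E.IsReturnTime (E.cylinder w) y t) (hz : z ∈ E.codingClass (t + w.length) y) :
    E.IsReturnTime (E.cylinder w) z t := by
  refine ⟨⟨ht.1.1, (map_pow_mem_cylinder_iff le_rfl hz).2 ht.1.2⟩, fun s hs => ?_⟩
  by_contra! hlt
  have h1 := (map_pow_mem_cylinder_iff (by omega) hz).1 hs.2
  exact absurd (ht.2 ⟨hs.1, h1⟩) (not_le.2 hlt)

theorem mem_cylinder_of_mem_codingClass {y z : Pt} {t : ℕ} (hy : y ∈ E.cylinder w)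
    (hz : z ∈ E.codingClass (t + w.length) y) : z ∈ E.cylinder w :=
  (map_pow_mem_cylinder_iff (s := 0) (by omega) hz).2 hy

theorem IsRegular.exists_isReturnTime (hE : E.IsRegular) {y : Pt} (hy : y ∈ E.cylinder w)
    (z : Pt) : ∃ t, E.IsReturnTime (E.cylinder w) z t := by
  obtain ⟨m, hm, h⟩ := hE.exists_ge_map_pow_mem z w.length y 1
  rw [← cylinder_eq_codingClass hy] at h
  have hne : {t : ℕ | 0 < t ∧ (E.map ^ t) z ∈ E.cylinder w}.Nonempty := ⟨m, hm, h⟩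
  exact ⟨_, Nat.sInf_mem hne, fun _ hs => Nat.sInf_le hs⟩

/-- The property of which the induced intervals of `I` are the maximal instances. -/
def IsReturnInterval (E : IntervalExchange k) (I J : Set Pt) : Prop :=
  J.Nonempty ∧ J ⊆ I ∧ J.OrdConnected ∧
    ∃ t : ℕ, (∀ y ∈ J, E.IsReturnTime I y t) ∧
      ∀ s < t, ∃ i : Fin k, ∀ y ∈ J, (E.map ^ s) y ∈ E.piece i

/-- Letters before time `t` agree by the single-interval condition, and the next `|w|` letters agree
because both points have returned to `I_w`. -/
theorem IsReturnInterval.subset_codingClass {J : Set Pt} {y : Pt} {t : ℕ}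
    (hJ : E.IsReturnInterval (E.cylinder w) J) (hy : y ∈ J)
    (ht : E.IsReturnTime (E.cylinder w) y t) : J ⊆ E.codingClass (t + w.length) y := by
  obtain ⟨-, -, -, t', ht', hl⟩ := hJ
  obtain rfl : t = t' := ht.unique (ht' y hy)
  intro z hz j hj
  rcases lt_or_ge j t with h | h
  · obtain ⟨i, hi⟩ := hl j h
    exact (mem_piece_iff.1 (hi z hz)).trans (mem_piece_iff.1 (hi y hy)).symm
  · obtain ⟨d, rfl⟩ := Nat.exists_eq_add_of_le h
    have h1 := mem_cylinder_iff.1 (ht' z hz).1.2 ⟨d, by omega⟩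
    have h2 := mem_cylinder_iff.1 ht.1.2 ⟨d, by omega⟩
    rw [coding_map_pow] at h1 h2
    exact h1.trans h2.symm

theorem isReturnInterval_codingClass {y : Pt} {t : ℕ} (hy : y ∈ E.cylinder w)
    (ht : E.IsReturnTime (E.cylinder w) y t) :
    E.IsReturnInterval (E.cylinder w) (E.codingClass (t + w.length) y) :=
  ⟨⟨y, E.self_mem_codingClass _ y⟩, fun _ hz => mem_cylinder_of_mem_codingClass hy hz,
    ordConnected_codingClass _ y, t, fun _ hz => ht.of_mem_codingClass hz,
    fun s hs => ⟨E.coding y s, fun _ hz => mem_piece_iff.2 (hz s (by omega))⟩⟩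

theorem isInducedInterval_codingClass {y : Pt} {t : ℕ} (hy : y ∈ E.cylinder w)
    (ht : E.IsReturnTime (E.cylinder w) y t) :
    E.IsInducedInterval (E.cylinder w) (E.codingClass (t + w.length) y) :=
  ⟨isReturnInterval_codingClass hy ht, fun _ hJ hle =>
    IsReturnInterval.subset_codingClass hJ (hle (E.self_mem_codingClass _ y)) ht⟩

theorem IsInducedInterval.eq_codingClass {J : Set Pt} {y : Pt} {t : ℕ}
    (hJ : E.IsInducedInterval (E.cylinder w) J) (hy : y ∈ J)
    (ht : E.IsReturnTime (E.cylinder w) y t) : J = E.codingClass (t + w.length) y := by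
  have h := IsReturnInterval.subset_codingClass hJ.1 hy ht
  exact h.antisymm (hJ.2 (isReturnInterval_codingClass (hJ.1.2.1 hy) ht) h)

/-! ### Left endpoints of the induced intervals -/

/-- `y ∈ I_w` is the least point of the induced interval containing it. -/
def IsInducedLeft (E : IntervalExchange k) (w : List (Fin k)) (y : Pt) : Prop :=
  y ∈ E.cylinder w ∧
    ∀ t, E.IsReturnTime (E.cylinder w) y t → IsLeast (E.codingClass (t + w.length) y) y

/-- `y` is the first point of `I_w` on the backward orbit of the nonzero cut `i`, from time
`|w|` on. -/
def IsCutPullback (E : IntervalExchange k) (w : List (Fin k)) (i : Fin k) (y : Pt) : Prop :=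
  i.val ≠ 0 ∧ ∃ s, IsLeast {s | w.length ≤ s ∧ (E.map⁻¹ ^ s) (E.cut i) ∈ E.cylinder w} s ∧
    y = (E.map⁻¹ ^ s) (E.cut i)

theorem map_pow_map_inv_pow (y : Pt) (n : ℕ) : (E.map ^ n) ((E.map⁻¹ ^ n) y) = y := by
  rw [inv_pow, perm_apply_inv_self]

theorem map_inv_pow_map_pow (y : Pt) (n : ℕ) : (E.map⁻¹ ^ n) ((E.map ^ n) y) = y := by
  rw [inv_pow, perm_inv_apply_self]

theorem map_pow_map_inv_pow_of_le (y : Pt) {m n : ℕ} (h : m ≤ n) :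
    (E.map ^ m) ((E.map⁻¹ ^ n) y) = (E.map⁻¹ ^ (n - m)) y := by
  obtain ⟨d, rfl⟩ := Nat.exists_eq_add_of_le h
  rw [pow_add, Equiv.Perm.mul_apply, map_pow_map_inv_pow, Nat.add_sub_cancel_left]

/-- If `t + s ≤ κ`, the return would be a visit at backward time `κ - t ≥ s`, earlier than `κ`. -/
theorem IsReturnTime.lt_of_backward {q : Pt} {s t κ : ℕ} {I : Set Pt}
    (hκ : ∀ r, s ≤ r → (E.map⁻¹ ^ r) q ∈ I → κ ≤ r)
    (ht : E.IsReturnTime I ((E.map⁻¹ ^ κ) q) t) : κ < t + s := by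
  by_contra! hle
  have h := ht.1.2
  rw [map_pow_map_inv_pow_of_le q (by omega)] at h
  have := hκ (κ - t) (by omega) h
  have := ht.1.1
  omega

theorem IsInducedLeft.eq_or_exists_isCutPullback (hE : E.IsRegular) {a ℓ : Pt}
    (ha : IsLeast (E.cylinder w) a) (hℓ : E.IsInducedLeft w ℓ) :
    ℓ = a ∨ ∃ i, E.IsCutPullback w i ℓ := by
  by_cases hne : ℓ = a
  · exact Or.inl hne
  right
  have hlt : a < ℓ := lt_of_le_of_ne (ha.2 hℓ.1) (Ne.symm hne)
  have hlt' : (a : ℝ) < ℓ := hlt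
  obtain ⟨t, ht⟩ := hE.exists_isReturnTime hℓ.1 ℓ
  have hleast := hℓ.2 t ht
  obtain ⟨ℓ', hℓ', h⟩ := exists_isLeast_codingClass (E := E) (t + w.length) ℓ
  obtain rfl : ℓ' = ℓ := hℓ'.unique hleast
  rcases h with h | ⟨j, hj, i, hi, h⟩
  · linarith [a.2.1]
  -- A cut met while `w` is being read bounds all of `I_w` on the left, which would force `ℓ' ≤ a`.
  have hjw : w.length ≤ j := by
    by_contra! hjw
    have hac : a ∈ E.codingClass w.length ℓ' := by
      rw [← cylinder_eq_codingClass hℓ.1]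
      exact ha.1
    have h1 := map_pow_sub_of_mem_codingClass (codingClass_anti hjw.le ℓ' hac)
    have h2 : E.letter ((E.map ^ j) a) = i := by
      have : E.letter ((E.map ^ j) a) = E.letter ((E.map ^ j) ℓ') := hac j hjw
      rw [this, h, letter_cut]
    have h3 : (E.cut (E.letter ((E.map ^ j) a)) : ℝ) ≤ ((E.map ^ j) a : Pt) := E.cut_le _
    rw [h2, ← h] at h3
    linarith
  have hback : ∀ s ≤ j, (E.map⁻¹ ^ s) (E.cut i) = (E.map ^ (j - s)) ℓ' := by
    intro s hs
    rw [← h]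
    conv_lhs => rw [← Nat.sub_add_cancel hs, add_comm, pow_add, Equiv.Perm.mul_apply,
      map_inv_pow_map_pow]
  refine ⟨i, hi, j, ⟨⟨hjw, ?_⟩, fun s hs => ?_⟩, ?_⟩
  · rw [hback j le_rfl]
    simpa using hℓ.1
  -- An earlier backward visit would be a return of `ℓ'` after `j - s` steps, and `j - s < t` since
  -- `|w| ≤ s`.
  · by_contra! hsj
    have h1 := hs.2
    rw [hback s hsj.le] at h1
    have h2 := ht.2 ⟨by omega, h1⟩
    have := hs.1
    omega
  · rw [hback j le_rfl]
    simp

theorem isInducedLeft_of_isLeast {a : Pt} (ha : IsLeast (E.cylinder w) a) :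
    E.IsInducedLeft w a :=
  ⟨ha.1, fun _ _ => ⟨E.self_mem_codingClass _ a,
    fun _ hz => ha.2 (mem_cylinder_of_mem_codingClass ha.1 hz)⟩⟩

/-- The cut is reached before time `t + |w|`, so all points of the class are sent by `T^s` into the
interval starting at that cut; `T^s` is a translation there. -/
theorem IsCutPullback.isInducedLeft {i : Fin k} {y : Pt} (h : E.IsCutPullback w i y) :
    E.IsInducedLeft w y := by
  obtain ⟨-, s, hs, rfl⟩ := h
  refine ⟨hs.1.2, fun t ht => ⟨E.self_mem_codingClass _ _, fun z hz => ?_⟩⟩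
  have hst := IsReturnTime.lt_of_backward (fun r h1 h2 => hs.2 ⟨h1, h2⟩) ht
  have h1 := map_pow_sub_of_mem_codingClass (codingClass_anti hst.le _ hz)
  have h2 : E.letter ((E.map ^ s) z) = _ := hz s hst
  rw [coding, map_pow_map_inv_pow, letter_cut] at h2
  have h3 : (E.cut (E.letter ((E.map ^ s) z)) : ℝ) ≤ ((E.map ^ s) z : Pt) := E.cut_le _
  rw [h2] at h3
  rw [map_pow_map_inv_pow] at h1
  exact Subtype.coe_le_coe.1 (by linarith)

/-- The minimum of `I_w` is `0` or reaches a nonzero cut before time `|w|`; reaching another one at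
time `s ≥ |w|` contradicts regularity. -/
theorem IsCutPullback.not_isLeast (hE : E.IsRegular) {i : Fin k} {y : Pt}
    (h : E.IsCutPullback w i y) : ¬IsLeast (E.cylinder w) y := by
  obtain ⟨hi, s, hs, rfl⟩ := h
  intro ha
  rw [cylinder_eq_codingClass ha.1] at ha
  obtain ⟨y, hy, h⟩ := exists_isLeast_codingClass (E := E) w.length ((E.map⁻¹ ^ s) (E.cut i))
  rw [hy.unique ha] at h
  have hk : 2 ≤ k := by
    have := i.2
    omega
  rcases h with h | ⟨j, hj, i', hi', h⟩
  · exact hE.map_pow_zero_ne_cut hk h s hi (map_pow_map_inv_pow _ _)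
  · have hjs : j < s := hj.trans_le hs.1.1
    rw [map_pow_map_inv_pow_of_le _ hjs.le] at h
    have h1 : (E.map ^ (s - j)) (E.cut i') = E.cut i := by rw [← h, map_pow_map_inv_pow]
    have := hE.eq_zero_of_map_pow_eq hi' hi h1
    omega

theorem IsRegular.exists_isCutPullback (hE : E.IsRegular) {y : Pt} (hy : y ∈ E.cylinder w)
    {i : Fin k} (hi : i.val ≠ 0) : ∃ z, E.IsCutPullback w i z := by
  obtain ⟨m, hm, h⟩ := hE.exists_ge_map_inv_pow_mem (E.cut i) w.length y w.length
  rw [← cylinder_eq_codingClass hy] at h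
  have hne : {s | w.length ≤ s ∧ (E.map⁻¹ ^ s) (E.cut i) ∈ E.cylinder w}.Nonempty := ⟨m, hm, h⟩
  exact ⟨_, hi, _, ⟨Nat.sInf_mem hne, fun _ hs => Nat.sInf_le hs⟩, rfl⟩

theorem IsCutPullback.eq_index (hE : E.IsRegular) {i j : Fin k} {y : Pt}
    (hi : E.IsCutPullback w i y) (hj : E.IsCutPullback w j y) : i = j := by
  obtain ⟨hi0, s, -, rfl⟩ := hi
  obtain ⟨hj0, s', -, h⟩ := hj
  refine (hE i j hi0 hj0 ((s' : ℤ) - s) ?_).2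
  rw [sub_eq_add_neg, zpow_add, zpow_natCast, zpow_neg, zpow_natCast, ← inv_pow,
    Equiv.Perm.mul_apply, h, map_pow_map_inv_pow]

theorem IsCutPullback.unique {i : Fin k} {y z : Pt}
    (hy : E.IsCutPullback w i y) (hz : E.IsCutPullback w i z) : y = z := by
  obtain ⟨-, s, hs, rfl⟩ := hy
  obtain ⟨-, s', hs', rfl⟩ := hz
  rw [hs.unique hs']

theorem exists_isLeast_cylinder (hw : (E.cylinder w).Nonempty) : ∃ a, IsLeast (E.cylinder w) a := by
  obtain ⟨y, hy⟩ := hw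
  obtain ⟨a, ha, -⟩ := exists_isLeast_codingClass (E := E) w.length y
  exact ⟨a, cylinder_eq_codingClass hy ▸ ha⟩

/-- There are exactly `k` left endpoints of induced intervals. -/
theorem IsRegular.exists_strictMono_range_eq (hE : E.IsRegular) (hw : (E.cylinder w).Nonempty) :
    ∃ ℓ : Fin k → Pt, StrictMono ℓ ∧ Set.range ℓ = {y | E.IsInducedLeft w y} := by
  obtain ⟨a, ha⟩ := exists_isLeast_cylinder hw
  -- Index `0` stands for the minimum of `I_w`, the other `k - 1` indices for the pullbacks of the
  -- nonzero cuts.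
  have hex : ∀ i : Fin k, ∃ y, (i.val = 0 ∧ y = a) ∨ E.IsCutPullback w i y := by
    intro i
    by_cases hi : i.val = 0
    · exact ⟨a, Or.inl ⟨hi, rfl⟩⟩
    · obtain ⟨y, hy⟩ := hE.exists_isCutPullback ha.1 hi
      exact ⟨y, Or.inr hy⟩
  choose g hg using hex
  have hinj : Function.Injective g := by
    intro i j hij
    rcases hg i with ⟨hi, hia⟩ | hi <;> rcases hg j with ⟨hj, hja⟩ | hj
    · exact Fin.ext (hi.trans hj.symm)
    · exact absurd (hij ▸ hia.symm ▸ ha) (hj.not_isLeast hE)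
    · exact absurd (hij ▸ hja.symm ▸ ha) (hi.not_isLeast hE)
    · exact (hij ▸ hi).eq_index hE hj
  have hrange : Set.range g = {y | E.IsInducedLeft w y} := by
    ext y
    constructor
    · rintro ⟨i, rfl⟩
      rcases hg i with ⟨-, hi⟩ | hi
      · exact hi ▸ isInducedLeft_of_isLeast ha
      · exact hi.isInducedLeft
    · intro hy
      rcases IsInducedLeft.eq_or_exists_isCutPullback hE ha hy with rfl | ⟨i, hi⟩
      · refine ⟨⟨0, E.pos_card⟩, ?_⟩
        rcases hg ⟨0, E.pos_card⟩ with ⟨-, h⟩ | h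
        · exact h
        · exact absurd rfl h.1
      · refine ⟨i, ?_⟩
        rcases hg i with ⟨h, -⟩ | h
        · exact absurd h hi.1
        · exact h.unique hi
  have hcard : (Finset.univ.image g).card = k := by
    rw [Finset.card_image_of_injective _ hinj, Finset.card_univ, Fintype.card_fin]
  refine ⟨(Finset.univ.image g).orderEmbOfFin hcard, OrderEmbedding.strictMono _, ?_⟩
  rw [Finset.range_orderEmbOfFin, Finset.coe_image, Finset.coe_univ, Set.image_univ, hrange]

theorem exists_mem_codingClass_isInducedLeft {y : Pt} {t : ℕ}
    (hy : y ∈ E.cylinder w) (ht : E.IsReturnTime (E.cylinder w) y t) :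
    ∃ z, E.IsInducedLeft w z ∧ y ∈ E.codingClass (t + w.length) z ∧
      E.IsReturnTime (E.cylinder w) z t := by
  obtain ⟨z, hz, -⟩ := exists_isLeast_codingClass (E := E) (t + w.length) y
  have heq := codingClass_eq hz.1
  have htz := ht.of_mem_codingClass hz.1
  refine ⟨z, ⟨mem_cylinder_of_mem_codingClass hy hz.1, fun t' ht' => ?_⟩, ?_, htz⟩
  · obtain rfl : t = t' := htz.unique ht'
    rwa [heq]
  · rw [heq]
    exact E.self_mem_codingClass _ y

/-! ### Return words and hitting times -/

theorem coding_map_pow_eq_wordSegment (x : Pt) (m n : ℕ) :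
    wordSegment (E.coding ((E.map ^ m) x)) 0 n = wordSegment (E.coding x) m n :=
  wordSegment_eq_iff.2 fun j _ => by rw [zero_add, coding_map_pow]

/-- The return words of `U(x)` are read off at the visits of the orbit of `x` to `I_w`. -/
theorem isReturnWord_append_iff {x : Pt} {u : List (Fin k)} :
    (∃ v, IsReturnWord (E.coding x) w v ∧ u = v ++ w) ↔
      ∃ m t : ℕ, (E.map ^ m) x ∈ E.cylinder w ∧
        E.IsReturnTime (E.cylinder w) ((E.map ^ m) x) t ∧
        u = wordSegment (E.coding ((E.map ^ m) x)) 0 (t + w.length) := by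
  have hshift : ∀ m s : ℕ, (E.map ^ s) ((E.map ^ m) x) = (E.map ^ (m + s)) x := fun m s => by
    rw [← Equiv.Perm.mul_apply, ← pow_add, add_comm]
  have happ : ∀ m t : ℕ, OccursAt (E.coding x) w (m + t) →
      wordSegment (E.coding x) m t ++ w =
        wordSegment (E.coding ((E.map ^ m) x)) 0 (t + w.length) := by
    intro m t h
    rw [coding_map_pow_eq_wordSegment, ← wordSegment_append, h]
  constructor
  · rintro ⟨_, ⟨m, n, hm, hn, rfl⟩, rfl⟩
    have hmn : m + (n - m) = n := by
      have := hn.1.1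
      omega
    refine ⟨m, n - m, occursAt_coding_iff.1 hm, ⟨⟨?_, ?_⟩, fun s hs => ?_⟩, ?_⟩
    · have := hn.1.1
      omega
    · rw [hshift, hmn]
      exact occursAt_coding_iff.1 hn.1.2
    · have h1 := hs.2
      have h0 := hs.1
      rw [hshift] at h1
      have := hn.2 ⟨by omega, occursAt_coding_iff.2 h1⟩
      omega
    · exact happ m _ (hmn.symm ▸ hn.1.2)
  · rintro ⟨m, t, hm, ht, rfl⟩
    have hocc : OccursAt (E.coding x) w (m + t) :=
      occursAt_coding_iff.2 (hshift m t ▸ ht.1.2)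
    refine ⟨_, ⟨m, m + t, occursAt_coding_iff.2 hm, ⟨⟨?_, hocc⟩, fun n hn => ?_⟩, rfl⟩, ?_⟩
    · have := ht.1.1
      omega
    · have h1 := hn.1
      have := ht.2 ⟨by omega, (show (E.map ^ (n - m)) ((E.map ^ m) x) ∈ E.cylinder w by
        rw [hshift, Nat.add_sub_cancel' h1.le]
        exact occursAt_coding_iff.1 hn.2)⟩
      omega
    · rw [Nat.add_sub_cancel_left]
      exact (happ m t hocc).symm

theorem map_zpow_neg (κ : ℕ) : E.map ^ (-(κ : ℤ)) = E.map⁻¹ ^ κ := by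
  rw [zpow_neg, zpow_natCast, inv_pow]

/-- The return time of the first point of `I` on the backward orbit of `q` is the sum of the
backward and the forward hitting times of `q`. -/
theorem IsBackwardHittingTime.exists_isReturnTime {I : Set Pt} {q : Pt} {κ t : ℕ}
    (hκ : E.IsBackwardHittingTime I q κ)
    (ht : E.IsReturnTime I ((E.map ^ (-(κ : ℤ))) q) t) :
    ∃ κ', E.IsReturnTime I q κ' ∧ t = κ + κ' := by
  rw [map_zpow_neg] at ht
  have hlt : κ < t := by
    refine IsReturnTime.lt_of_backward (s := 0) (fun r _ h => hκ.2 ?_) ht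
    change (E.map ^ (-(r : ℤ))) q ∈ I
    rwa [map_zpow_neg]
  have hshift : ∀ s : ℕ, (E.map ^ (κ + s)) ((E.map⁻¹ ^ κ) q) = (E.map ^ s) q := fun s => by
    rw [add_comm, pow_add, Equiv.Perm.mul_apply, map_pow_map_inv_pow]
  refine ⟨t - κ, ⟨⟨by omega, ?_⟩, fun s hs => ?_⟩, by omega⟩
  · rw [← hshift, Nat.add_sub_cancel' hlt.le]
    exact ht.1.2
  · have h0 := hs.1
    have := ht.2 ⟨by omega, (hshift s).symm ▸ hs.2⟩
    omega

theorem isBackwardHittingTime_zero {I : Set Pt} {y : Pt} (hy : y ∈ I) :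
    E.IsBackwardHittingTime I y 0 :=
  ⟨show (E.map ^ (-((0 : ℕ) : ℤ))) y ∈ I by rwa [map_zpow_neg, pow_zero],
    fun _ _ => Nat.zero_le _⟩

end IntervalExchange

/-! ### Enumeration of the intervals and their words -/

theorem mainTheorem3 {k : ℕ} (E : IntervalExchange k) (hE : E.IsRegular)
    (x : IntervalExchange.Pt) (w : List (Fin k)) (hw : IsFactorOf w (E.coding x)) :
    ∃ (p : Fin k → Set IntervalExchange.Pt) (ℓ : Fin k → IntervalExchange.Pt)
      (r : Fin k → List (Fin k)),
      -- `p 0, …, p (k - 1)` are all the induced intervals of `I_w`, from left to right,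
      -- they cover `I_w`, and `ℓ i` is the left endpoint of `p i`
      Set.range p = {J | E.IsInducedInterval (E.cylinder w) J} ∧
      (∀ i j : Fin k, i < j → ∀ y ∈ p i, ∀ z ∈ p j, y < z) ∧
      (⋃ i, p i) = E.cylinder w ∧
      (∀ i, IsLeast (p i) (ℓ i)) ∧
      -- `r i` is the word associated with `p i`: the coding of any point of `p i` from the
      -- occurrence of `w` at time `0` to the end of the next occurrence of `w`
      (∀ i, ∀ y ∈ p i, ∃ t : ℕ, E.IsReturnTime (E.cylinder w) y t ∧
        r i = wordSegment (E.coding y) 0 (t + w.length)) ∧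
      -- `i ↦ r i` enumerates without repetition the return words over `w`, each followed by `w`
      Function.Injective r ∧
      Set.range r = {u | ∃ v, IsReturnWord (E.coding x) w v ∧ u = v ++ w} ∧
      -- the length formula at the left endpoint
      (∀ i, ∃ κ κ' : ℕ, E.IsBackwardHittingTime (E.cylinder w) (ℓ i) κ ∧
        E.IsReturnTime (E.cylinder w) (ℓ i) κ' ∧
        (r i).length = w.length + κ + κ') ∧
      -- the length formula at any point whose backward orbit first meets `I_w` in `ℓ i`
      (∀ i, ∀ (q : IntervalExchange.Pt) (κ : ℕ),
        E.IsBackwardHittingTime (E.cylinder w) q κ → (E.map ^ (-(κ : ℤ))) q = ℓ i →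
        ∃ κ' : ℕ, E.IsReturnTime (E.cylinder w) q κ' ∧
          (r i).length = w.length + κ + κ') := by
  have hne : (E.cylinder w).Nonempty := by
    obtain ⟨n, hn⟩ := hw
    exact ⟨_, IntervalExchange.occursAt_coding_iff.1 hn⟩
  obtain ⟨ℓ, hmono, hrange⟩ := hE.exists_strictMono_range_eq hne
  have hℓ : ∀ i, E.IsInducedLeft w (ℓ i) := fun i => by
    have : ℓ i ∈ Set.range ℓ := ⟨i, rfl⟩
    rwa [hrange] at this
  choose t ht using fun i => hE.exists_isReturnTime (hℓ i).1 (ℓ i)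
  have hleast : ∀ i, IsLeast (E.codingClass (t i + w.length) (ℓ i)) (ℓ i) :=
    fun i => (hℓ i).2 _ (ht i)
  have hclass : ∀ i j, ℓ j ∈ E.codingClass (t i + w.length) (ℓ i) → i = j := by
    intro i j h
    have htj := (ht i).of_mem_codingClass h
    have h1 := (hℓ j).2 _ htj
    rw [IntervalExchange.codingClass_eq h] at h1
    exact hmono.injective ((hleast i).unique h1)
  have hcover : ∀ y s, y ∈ E.cylinder w → E.IsReturnTime (E.cylinder w) y s →
      ∃ i, s = t i ∧ y ∈ E.codingClass (t i + w.length) (ℓ i) := by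
    intro y s hy hs
    obtain ⟨z, hz, hyz, hsz⟩ := IntervalExchange.exists_mem_codingClass_isInducedLeft hy hs
    obtain ⟨i, rfl⟩ : z ∈ Set.range ℓ := hrange ▸ hz
    obtain rfl : s = t i := hsz.unique (ht i)
    exact ⟨i, rfl, hyz⟩
  have hword : ∀ i, ∀ y ∈ E.codingClass (t i + w.length) (ℓ i),
      wordSegment (E.coding (ℓ i)) 0 (t i + w.length) =
        wordSegment (E.coding y) 0 (t i + w.length) := fun i y hy =>
    wordSegment_eq_iff.2 fun j hj => by simpa using (hy j hj).symm
  refine ⟨fun i => E.codingClass (t i + w.length) (ℓ i), ℓ,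
    fun i => wordSegment (E.coding (ℓ i)) 0 (t i + w.length), ?_, ?_, ?_, hleast, ?_, ?_, ?_, ?_,
    ?_⟩
  · ext J
    constructor
    · rintro ⟨i, rfl⟩
      exact IntervalExchange.isInducedInterval_codingClass (hℓ i).1 (ht i)
    · intro hJ
      obtain ⟨y, hy⟩ := hJ.1.1
      have hyI := hJ.1.2.1 hy
      obtain ⟨s, hs⟩ := hE.exists_isReturnTime hyI y
      obtain ⟨i, rfl, hi⟩ := hcover y s hyI hs
      exact ⟨i, ((hJ.eq_codingClass hy hs).trans (IntervalExchange.codingClass_eq hi)).symm⟩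
  -- If the order failed, `ℓ i < ℓ j ≤ y`, and convexity would put `ℓ j` in the class of `ℓ i`.
  · intro i j hij y hy z hz
    by_contra! hzy
    have h1 : ℓ j ≤ y := ((hleast j).2 hz).trans hzy
    exact hij.ne (hclass i j
      (IntervalExchange.mem_codingClass_of_le_of_le (hleast i).1 hy (hmono hij).le h1))
  · ext y
    rw [Set.mem_iUnion]
    constructor
    · rintro ⟨i, hi⟩
      exact IntervalExchange.mem_cylinder_of_mem_codingClass (hℓ i).1 hi
    · intro hy
      obtain ⟨s, hs⟩ := hE.exists_isReturnTime hy y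
      obtain ⟨i, -, hi⟩ := hcover y s hy hs
      exact ⟨i, hi⟩
  · exact fun i y hy => ⟨t i, (ht i).of_mem_codingClass hy, hword i y hy⟩
  · intro i j hij
    simp only at hij
    -- Equal words have equal lengths, hence equal return times, so they describe the same coding
    -- class.
    have hlen : t i + w.length = t j + w.length := by
      simpa only [length_wordSegment] using congrArg List.length hij
    rw [← hlen] at hij
    exact hclass i j fun s hs => by simpa using (wordSegment_eq_iff.1 hij s hs).symm
  · ext u
    refine Iff.trans ?_ IntervalExchange.isReturnWord_append_iff.symm
    constructor
    · rintro ⟨i, rfl⟩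
      -- Recurrence: the orbit of `x` enters every induced interval, so every `r i` is read in
      -- `U(x)`.
      obtain ⟨m, -, hm⟩ := hE.exists_ge_map_pow_mem x (t i + w.length) (ℓ i) 0
      exact ⟨m, t i, IntervalExchange.mem_cylinder_of_mem_codingClass (hℓ i).1 hm,
        (ht i).of_mem_codingClass hm, hword i _ hm⟩
    · rintro ⟨m, s, hm, hs, rfl⟩
      obtain ⟨i, rfl, hi⟩ := hcover _ s hm hs
      exact ⟨i, hword i _ hi⟩
  -- As `ℓ i` is itself in `I_w`, its backward hitting time is `0`.
  · refine fun i => ⟨0, t i, IntervalExchange.isBackwardHittingTime_zero (hℓ i).1, ht i, ?_⟩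
    rw [length_wordSegment]
    omega
  · intro i q κ hκ hq
    obtain ⟨κ', h1, h2⟩ := hκ.exists_isReturnTime (hq.symm ▸ ht i)
    refine ⟨κ', h1, ?_⟩
    rw [length_wordSegment]
    omega
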